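/- Let $\lambda,\Omega,T>0$, and let $\mathcal M_\lambda(x)=x-2\lambda\lfloor (x+\lambda)/(2\lambda)\rfloor$. Let $g:\mathbb R\to\mathbb R$ belong to $\mathrm{PW}_\Omega$, i.e. $g$ is continuous, $g\in L^2(\mathbb R)$, and its Fourier transform vanishes a.e. outside the angular frequency band $[-\Omega,\Omega]$; assume $\|g\|_\infty=\sup_t|g(t)|<\infty$ and let $\beta_g\ge\|g\|_\infty$. Put $\gamma[k]=g(kT)$ for $k\in\mathbb Z$, let $\eta:\mathbb Z\to\mathbb R$ be bounded noise with $\|\eta\|_\infty=\sup_k|\eta[k]|$, and let $y_\eta[k]=\mathcal M_\lambda(\gamma[k])+\eta[k]$ be the noisy modulo samples. Put $\rho=\|g\|_\infty/\lambda$, $\rho_\eta=\|\eta\|_\infty/\lambda$, $f_s=1/T$, $B=\Omega/(2\pi)$ and $\mathrm{OF}=f_s/(2B)$. Let $(\Delta x)[k]=x[k+1]-x[k]$, and let $\mathrm S$ be the anti-difference based at index $1$: $(\mathrm Sx)[k]=\sum_{m=1}^{k-1}x[m]$ for $k\ge1$ (so $(\mathrm Sx)[1]=0$) and $(\mathrm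 Sx)[k]=-\sum_{m=k}^{0}x[m]$ for $k\le 0$. For a fixed order $N\ge1$ the recovery algorithm computes, from $y_\eta$, $\lambda$, $\beta_g$ and $N$ only, $$s_{(0)}=\mathcal M_\lambda(\Delta^Ny_\eta)-\Delta^Ny_\eta ,\qquad J=\Bigl\lceil 4\Bigl(\frac{\beta_g}{\lambda}+2^{N-2}\Bigr)\Bigr\rceil ,$$ then, for $n=0,1,\dots,N-2$, $$\kappa_n=\Bigl\lfloor\frac{(\mathrm S^2s_{(n)})[1]-(\mathrm S^2s_{(n)})[J+1]}{2J\lambda}+\frac12\Bigr\rfloor,\qquad s_{(n+1)}[k]=2\lambda\Bigl\lfloor\frac{(\mathrm Ss_{(n)})[k]}{2\lambda}\Bigr\rceil+2\lambda\kappa_n ,$$ where $\lfloor\cdot\rceil$ is rounding to the nearest integer, and it outputs $\tilde\gamma[k]=(\mathrm Ss_{(N-1)})[k]+y_\eta[k]+2m_0\lambda$, where $m_0\in\mathbb Z$ is free. **Theorem 1.** 1. If $$(\Omega T)^N\|g\|_\infty+2^N\|\eta\|_\infty<\lambda,\qquad(\ast)$$ then for every choice of $m_0\in\mathbb Z$ there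 is $m\in\mathbb Z$ such that $\tilde\gamma[k]=\gamma[k]+\eta[k]+2m\lambda$ for all $k\in\mathbb Z$. 2. Condition $(\ast)$ holds if and only if $$2^N\rho_\eta<1\quad\text{and}\quad \mathrm{OF}>\pi\Bigl(\frac{\rho}{1-2^N\rho_\eta}\Bigr)^{1/N}.$$ 3. If $\eta\equiv0$, then $(\ast)$ holds if and only if $\mathrm{OF}>\pi\rho^{1/N}$. 4. If $g\not\equiv0$, then $\pi\rho^{1/n}\to\pi$ as $n\to\infty$, i.e. the oversampling factor required in the noiseless case tends to $\pi$ as the difference order tends to infinity. -/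

import Mathlib

open Real Filter Topology MeasureTheory
open scoped FourierTransform

noncomputable section

namespace ModuloSampling

/-- The sup norm `inf {c ≥ 0 : |x i| ≤ c for all i}` of a real function or a real sequence
(always used together with boundedness of `x`). -/
def supNorm {ι : Type*} (x : ι → ℝ) : ℝ :=
  sInf {c : ℝ | 0 ≤ c ∧ ∀ i, |x i| ≤ c}

/-- `g ∈ PW_Ω`: the real signal `g` is continuous, has finite energy, and its `L²` Fourier
transform vanishes almost everywhere outside the band `[-Ω, Ω]` of angular frequencies.
Mathlib's transform uses `exp (-2πi ξ t)`, so the angular frequency is `ω = 2πξ`. -/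
def PaleyWiener (Ω : ℝ) (g : ℝ → ℝ) : Prop :=
  Continuous g ∧
    ∃ h : MemLp (fun t : ℝ => (g t : ℂ)) 2 (volume : Measure ℝ),
      ∀ᵐ ξ : ℝ, Ω < |2 * π * ξ| →
        (𝓕 (h.toLp (fun t : ℝ => (g t : ℂ))) : Lp ℂ 2 (volume : Measure ℝ)) ξ = 0

/-- The centred modulo operation with threshold `lam`. -/
def modulo (lam x : ℝ) : ℝ :=
  x - 2 * lam * (⌊(x + lam) / (2 * lam)⌋ : ℝ)

/-- Uniform samples `γ[k] = g(kT)`. -/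
def samples (g : ℝ → ℝ) (T : ℝ) (k : ℤ) : ℝ := g (k * T)

/-- Noisy modulo samples `y_η[k] = M_λ(g(kT)) + η[k]`. -/
def noisyModuloSamples (lam : ℝ) (g : ℝ → ℝ) (T : ℝ) (η : ℤ → ℝ) (k : ℤ) : ℝ :=
  modulo lam (samples g T k) + η k

/-- The `N`-th forward difference of a sequence, `(Δx)[k] = x[k+1] - x[k]`. -/
def diff (N : ℕ) (x : ℤ → ℝ) : ℤ → ℝ := (fwdDiff (1 : ℤ))^[N] x

/-- The anti-difference `S`, based at index `1`: `(Sx)[k] = ∑_{1 ≤ m < k} x[m]` for `k ≥ 1`,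
and `(Sx)[k] = -∑_{k ≤ m < 1} x[m]` for `k ≤ 0`. It is the solution of `Δ(Sx) = x` with
`(Sx)[1] = 0`, so that `S(Δx)[k] = x[k] - x[1]`. -/
def antiDiff (x : ℤ → ℝ) (k : ℤ) : ℝ :=
  ∑ m ∈ Finset.Ico 1 k, x m - ∑ m ∈ Finset.Ico k 1, x m

/-- The block length `J = ⌈4 (β/λ + 2^(N-2))⌉` (real exponentiation, so `2^(-1)` for `N = 1`). -/
def blockLength (lam β : ℝ) (N : ℕ) : ℤ :=
  ⌈4 * (β / lam + (2 : ℝ) ^ ((N : ℤ) - 2))⌉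

/-- The integer `κ` that fixes the constant of the next anti-difference of `s`. -/
def kappa (lam : ℝ) (J : ℤ) (s : ℤ → ℝ) : ℤ :=
  ⌊(antiDiff (antiDiff s) 1 - antiDiff (antiDiff s) (J + 1)) / (2 * J * lam) + 1 / 2⌋

/-- One pass of the loop: anti-difference, rounding to `2λℤ`, and addition of `2λκ`. -/
def loopStep (lam : ℝ) (J : ℤ) (s : ℤ → ℝ) (k : ℤ) : ℝ :=
  2 * lam * (round (antiDiff s k / lam / 2) : ℝ) + 2 * lam * (kappa lam J s : ℝ)

/-- Unwrapping at the level of `N`-th differences: `M_λ(Δ^N y) - Δ^N y`. -/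
def unwrappedDiff (lam : ℝ) (N : ℕ) (y : ℤ → ℝ) (k : ℤ) : ℝ :=
  modulo lam (diff N y k) - diff N y k

/-- The fixed-order difference recovery algorithm. Its input is the sequence `y` of noisy modulo
samples, the threshold `lam`, the amplitude bound `β`, and the order `N ≥ 1`; the loop is run
`N - 1` times. The integer `m` is the free integer of the last line of the algorithm. -/
def recover (lam β : ℝ) (N : ℕ) (y : ℤ → ℝ) (m : ℤ) (k : ℤ) : ℝ :=
  antiDiff ((loopStep lam (blockLength lam β N))^[N - 1] (unwrappedDiff lam N y)) k
    + y k + 2 * m * lam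

/-- The oversampling factor `OF = f_s / (2B)` with `f_s = 1/T` and `B = Ω/(2π)`. -/
def oversamplingFactor (Ω T : ℝ) : ℝ := (1 / T) / (2 * (Ω / (2 * π)))

/-- The sampling condition `(ΩT)^N ‖g‖_∞ + 2^N ‖η‖_∞ < λ`. -/
def RecoveryCondition (lam Ω T : ℝ) (g : ℝ → ℝ) (η : ℤ → ℝ) (N : ℕ) : Prop :=
  (Ω * T) ^ N * supNorm g + 2 ^ N * supNorm η < lam

end ModuloSampling

end

/-!
The algorithm works because folding commutes with differences modulo the lattice `2λℤ`, and
because high order differences of an oversampled bandlimited signal are small.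

The analytic ingredient is Bernstein's inequality with the sharp constant. By Fourier inversion, a
Paley-Wiener signal is the Fourier transform of an integrable function supported in the band
(`PaleyWiener.isBandlimited`). On the band, `ω` agrees with a triangle wave, and its absolutely
convergent Fourier series (obtained from the series of the Bernoulli polynomial `B₂`) yields
M. Riesz' interpolation formula, which writes the derivative as a sum of translates with
coefficients of total mass `Ω` (`IsBandlimited.exists_hasDerivAt`). Hence an increment over a step
`T` is at most `ΩT` times the sup norm, and since increments are again bandlimited, the `N`-th
differences of the samples are at most `(ΩT)^N ‖g‖_∞` (`PaleyWiener.abs_diff_samples_le`).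

For the algorithm, let `e = γ - M_λ(γ)`, a sequence with values in `2λℤ`, so that `y = γ + η - e`.
Under the sampling condition `Δ^N (γ + η)` stays below `λ`, so folding `Δ^N y` returns it exactly,
and the initial sequence is `Δ^N e`. Each pass of the loop turns `Δ (Δ z)` into `Δ z`, where `z` is
a lower order difference of `e`. The anti-difference loses only the constant `Δ z [1] ∈ 2λℤ`, so the
rounding is exact, and that constant is the average of `Δ z` over a block of length `J`, up to the
increment of `z` over the block divided by `J`. The choice of `J` makes this error less than `λ`,
half the lattice spacing (`kappa_fwdDiff_fwdDiff`, `loopStep_fwdDiff_fwdDiff`). The last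
anti-difference returns `e` up to a constant in `2λℤ`. The form of the sampling condition in terms
of the oversampling factor is algebra (`recoveryCondition_iff`).
-/

namespace ModuloSampling

/-! ### A Fourier series for the triangle wave -/

theorem hasSum_cos_div_sq {x : ℝ} (hx : x ∈ Set.Icc (0 : ℝ) 1) :
    HasSum (fun n : ℕ => 1 / (n : ℝ) ^ 2 * cos (2 * π * n * x))
      (π ^ 2 * (x ^ 2 - x + 1 / 6)) := by
  have h := hasSum_one_div_nat_pow_mul_cos (k := 1) one_ne_zero hx
  have hB : (Polynomial.map (algebraMap ℚ ℝ) (Polynomial.bernoulli (2 * 1))).eval x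
      = x ^ 2 - x + 1 / 6 := by
    simp [Polynomial.bernoulli_def, Finset.sum_range_succ, bernoulli_one, bernoulli_two]
    ring
  rw [hB] at h
  convert! h using 1
  rw [show Nat.factorial (2 * 1) = 2 from rfl]
  push_cast
  ring

theorem hasSum_cos_odd_div_sq {x : ℝ} (hx : x ∈ Set.Icc (0 : ℝ) (1 / 2)) :
    HasSum (fun k : ℕ => 1 / (2 * (k : ℝ) + 1) ^ 2 * cos ((2 * k + 1) * (2 * π * x)))
      (π ^ 2 / 8 * (1 - 4 * x)) := by
  have h1 := hasSum_cos_div_sq (x := x) ⟨hx.1, by linarith [hx.2]⟩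
  have h2 := (hasSum_cos_div_sq (x := 2 * x) ⟨by linarith [hx.1], by linarith [hx.2]⟩).mul_left
    (1 / 4)
  set f : ℕ → ℝ := fun n => 1 / (n : ℝ) ^ 2 * cos (2 * π * n * x) with hf
  have he : HasSum (fun k : ℕ => f (2 * k)) (1 / 4 * (π ^ 2 * ((2 * x) ^ 2 - 2 * x + 1 / 6))) := by
    convert! h2 using 2 with k
    simp only [hf]
    push_cast
    rw [show 2 * π * (2 * (k : ℝ)) * x = 2 * π * k * (2 * x) by ring, mul_pow, one_div, mul_inv]
    ring
  have hos : Summable (fun k : ℕ => f (2 * k + 1)) :=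
    h1.summable.comp_injective (i := fun k : ℕ => 2 * k + 1) fun a b hab => by
      simpa using hab
  have hsum := (he.even_add_odd hos.hasSum).unique h1
  convert! hos.hasSum using 1
  · funext k
    simp only [hf]
    push_cast
    congr 2
    ring
  · linear_combination -hsum

/-- On `[-π/2, π/2]` the identity function equals the triangle wave, whose Fourier coefficients
are absolutely summable. -/
theorem hasSum_sin_odd_div_sq {φ : ℝ} (hφ : |φ| ≤ π / 2) :
    HasSum (fun k : ℕ => (-1) ^ k / (2 * (k : ℝ) + 1) ^ 2 * sin ((2 * k + 1) * φ))
      (π / 4 * φ) := by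
  obtain ⟨h1, h2⟩ := abs_le.1 hφ
  have hx : (π / 2 - φ) / (2 * π) ∈ Set.Icc (0 : ℝ) (1 / 2) := by
    constructor
    · exact div_nonneg (by linarith) (by positivity)
    · rw [div_le_iff₀ (by positivity)]; linarith
  convert! hasSum_cos_odd_div_sq hx using 1
  · funext k
    rw [mul_div_cancel₀ _ (by positivity)]
    have : (2 * (k : ℝ) + 1) * (π / 2 - φ) = π / 2 - (2 * k + 1) * φ + k * π := by ring
    rw [this, cos_add_nat_mul_pi, cos_pi_div_two_sub]
    ring
  · field_simp
    ring

theorem hasSum_odd_div_sq :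
    HasSum (fun k : ℕ => 1 / (2 * (k : ℝ) + 1) ^ 2) (π ^ 2 / 8) := by
  simpa using hasSum_cos_odd_div_sq (x := 0) (by norm_num)

/-! ### Bernstein's inequality -/

/-- `f` is the Fourier transform of an integrable function that vanishes almost everywhere
outside the band `[-Ω, Ω]` of angular frequencies `ω = 2πξ`. -/
def IsBandlimited (Ω : ℝ) (f : ℝ → ℂ) : Prop :=
  ∃ G : ℝ → ℂ, Integrable G ∧ (∀ᵐ ξ : ℝ, Ω < |2 * π * ξ| → G ξ = 0) ∧ f = 𝓕 G

/-- The coefficients of M. Riesz' interpolation formula for the derivative. -/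
noncomputable def rieszCoeff (Ω : ℝ) (k : ℕ) : ℝ :=
  4 * Ω / π ^ 2 * ((-1) ^ k / (2 * (k : ℝ) + 1) ^ 2)

/-- The nodes of M. Riesz' interpolation formula are `t ± rieszNode Ω k`. -/
noncomputable def rieszNode (Ω : ℝ) (k : ℕ) : ℝ := (2 * k + 1) * π / (2 * Ω)

theorem abs_rieszCoeff {Ω : ℝ} (hΩ : 0 < Ω) (k : ℕ) :
    |rieszCoeff Ω k| = 4 * Ω / π ^ 2 * (1 / (2 * (k : ℝ) + 1) ^ 2) := by
  rw [rieszCoeff, abs_mul, abs_of_nonneg (by positivity : 0 ≤ 4 * Ω / π ^ 2), abs_div, abs_pow,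
    abs_neg, abs_one, one_pow, abs_of_nonneg (by positivity : 0 ≤ (2 * (k : ℝ) + 1) ^ 2)]

theorem hasSum_abs_rieszCoeff {Ω : ℝ} (hΩ : 0 < Ω) :
    HasSum (fun k => |rieszCoeff Ω k|) (Ω / 2) := by
  simp only [abs_rieszCoeff hΩ]
  convert! hasSum_odd_div_sq.mul_left (4 * Ω / π ^ 2) using 1
  field_simp
  norm_num

/-- Riesz' formula for a single exponential `t ↦ exp (-iωt)` with `|ω| ≤ Ω`. -/
theorem hasSum_rieszCoeff_exp {Ω ω : ℝ} (hΩ : 0 < Ω) (hω : |ω| ≤ Ω) (t : ℝ) :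
    HasSum (fun k => (rieszCoeff Ω k : ℂ) *
        (Complex.exp (↑(-ω * (t + rieszNode Ω k)) * Complex.I)
          - Complex.exp (↑(-ω * (t - rieszNode Ω k)) * Complex.I)))
      (-Complex.I * ω * Complex.exp (↑(-ω * t) * Complex.I)) := by
  have hφ : |π * ω / (2 * Ω)| ≤ π / 2 := by
    rw [abs_div, abs_mul, abs_of_pos pi_pos, abs_of_pos (by positivity : 0 < 2 * Ω),
      div_le_iff₀ (by positivity)]
    nlinarith [pi_pos]
  have h := ((hasSum_sin_odd_div_sq hφ).mul_left (4 * Ω / π ^ 2))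
  have h' := (Complex.hasSum_ofReal.2 h).mul_left
    (-2 * Complex.I * Complex.exp (↑(-ω * t) * Complex.I))
  convert! h' using 1
  · funext k
    have hs : (sin ((2 * k + 1) * (π * ω / (2 * Ω))) : ℂ)
        = (Complex.exp (-↑(ω * rieszNode Ω k) * Complex.I)
          - Complex.exp (↑(ω * rieszNode Ω k) * Complex.I)) * Complex.I / 2 := by
      rw [show ((2 * k + 1) * (π * ω / (2 * Ω)) : ℝ) = ω * rieszNode Ω k by
        rw [rieszNode]; ring]
      rw [Complex.ofReal_sin, Complex.sin]
    rw [← mul_assoc (4 * Ω / π ^ 2), ← rieszCoeff, Complex.ofReal_mul (rieszCoeff Ω k), hs,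
      show ((↑(-ω * (t + rieszNode Ω k)) : ℂ) * Complex.I)
        = ↑(-ω * t) * Complex.I + -↑(ω * rieszNode Ω k) * Complex.I by push_cast; ring,
      show ((↑(-ω * (t - rieszNode Ω k)) : ℂ) * Complex.I)
        = ↑(-ω * t) * Complex.I + ↑(ω * rieszNode Ω k) * Complex.I by push_cast; ring,
      Complex.exp_add, Complex.exp_add]
    linear_combination ((rieszCoeff Ω k : ℂ) * Complex.exp (↑(-ω * t) * Complex.I) *
      (Complex.exp (-↑(ω * rieszNode Ω k) * Complex.I)
          - Complex.exp (↑(ω * rieszNode Ω k) * Complex.I))) * Complex.I_sq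
  · rw [show (4 * Ω / π ^ 2 * (π / 4 * (π * ω / (2 * Ω))) : ℝ) = ω / 2 by field_simp]
    push_cast
    ring

/-- A bandlimited function is differentiable, and its derivative is given by M. Riesz'
interpolation formula. -/
theorem IsBandlimited.exists_hasDerivAt {Ω : ℝ} (hΩ : 0 < Ω) {f : ℝ → ℂ}
    (hf : IsBandlimited Ω f) (t : ℝ) :
    ∃ d : ℂ, HasDerivAt f d t ∧
      HasSum (fun k => (rieszCoeff Ω k : ℂ) * (f (t + rieszNode Ω k) - f (t - rieszNode Ω k))) d := by
  obtain ⟨G, hG, hsupp, rfl⟩ := hf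
  have hG' : Integrable (fun ξ : ℝ => ξ • G ξ) := by
    refine (hG.norm.const_mul (Ω / (2 * π))).mono'
      (continuous_id.aestronglyMeasurable.smul hG.1) ?_
    filter_upwards [hsupp] with ξ hξ
    rw [norm_smul, Real.norm_eq_abs]
    by_cases h : Ω < |2 * π * ξ|
    · simp [hξ h]
    · gcongr
      rw [le_div_iff₀ (by positivity)]
      rw [abs_mul, abs_of_pos (by positivity : 0 < 2 * π)] at h
      linarith
  refine ⟨_, Real.hasDerivAt_fourier hG hG' t, ?_⟩
  have hexp : ∀ s : ℝ, Integrable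
      (fun ξ : ℝ => Complex.exp (↑(-2 * π * ξ * s) * Complex.I) * G ξ) := fun s => by
    refine hG.norm.mono' ((by fun_prop : Continuous fun ξ : ℝ =>
      Complex.exp (↑(-2 * π * ξ * s) * Complex.I)).aestronglyMeasurable.mul hG.1) ?_
    filter_upwards with ξ
    rw [norm_mul, Complex.norm_exp_ofReal_mul_I, one_mul]
  have key := hasSum_integral_of_dominated_convergence (μ := volume)
    (F := fun k ξ => (rieszCoeff Ω k : ℂ) *
      (Complex.exp (↑(-2 * π * ξ * (t + rieszNode Ω k)) * Complex.I) * G ξ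
        - Complex.exp (↑(-2 * π * ξ * (t - rieszNode Ω k)) * Complex.I) * G ξ))
    (f := fun ξ => Complex.exp (↑(-2 * π * ξ * t) * Complex.I) •
      ((-2 * π * Complex.I * ξ) • G ξ))
    (fun k ξ => |rieszCoeff Ω k| * (2 * ‖G ξ‖)) ?_ ?_ ?_ ?_ ?_
  · rw [Real.fourier_real_eq_integral_exp_smul]
    convert! key using 1
    funext k
    rw [integral_const_mul, integral_sub (hexp _) (hexp _),
      Real.fourier_real_eq_integral_exp_smul, Real.fourier_real_eq_integral_exp_smul]
    simp only [smul_eq_mul]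
  · exact fun k => (((hexp _).sub (hexp _)).const_mul _).1
  · intro k
    filter_upwards with ξ
    rw [norm_mul, Complex.norm_real, Real.norm_eq_abs]
    gcongr
    refine (norm_sub_le _ _).trans_eq ?_
    rw [norm_mul, norm_mul, Complex.norm_exp_ofReal_mul_I, Complex.norm_exp_ofReal_mul_I]
    ring
  · filter_upwards with ξ
    exact (hasSum_abs_rieszCoeff hΩ).summable.mul_right _
  · simp_rw [tsum_mul_right]
    exact (hG.norm.const_mul 2).const_mul _
  · filter_upwards [hsupp] with ξ hξ
    by_cases h : Ω < |2 * π * ξ|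
    · simp [hξ h, hasSum_zero]
    · have := (hasSum_rieszCoeff_exp hΩ (not_lt.1 h) t).mul_right (G ξ)
      convert! this using 1
      · funext k
        rw [show -2 * π * ξ = -(2 * π * ξ) by ring]
        ring
      · rw [show -2 * π * ξ = -(2 * π * ξ) by ring, smul_eq_mul, smul_eq_mul]
        push_cast
        ring

/-- Bernstein's inequality, for the increment over a step `T` in place of the derivative. -/
theorem IsBandlimited.norm_add_sub_le {Ω : ℝ} (hΩ : 0 < Ω) {f : ℝ → ℂ} (hf : IsBandlimited Ω f)
    {C : ℝ} (hC : ∀ t, ‖f t‖ ≤ C) {T : ℝ} (hT : 0 ≤ T) (t : ℝ) :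
    ‖f (t + T) - f t‖ ≤ Ω * T * C := by
  choose d hd hsum using hf.exists_hasDerivAt hΩ
  have hbound : ∀ s, ‖d s‖ ≤ Ω * C := fun s => by
    have h2 := (hasSum_abs_rieszCoeff hΩ).mul_right (2 * C)
    rw [← (hsum s).tsum_eq]
    refine (tsum_of_norm_bounded h2 fun k => ?_).trans_eq (by ring)
    rw [norm_mul, Complex.norm_real, Real.norm_eq_abs]
    gcongr
    refine (norm_sub_le _ _).trans ?_
    linarith [hC (s + rieszNode Ω k), hC (s - rieszNode Ω k)]
  have := Convex.norm_image_sub_le_of_norm_hasDerivWithin_le (s := Set.univ)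
    (fun s _ => (hd s).hasDerivWithinAt) (fun s _ => hbound s) convex_univ
    (Set.mem_univ t) (Set.mem_univ (t + T))
  rw [add_sub_cancel_left, Real.norm_of_nonneg hT] at this
  linarith

theorem IsBandlimited.comp_fwdDiff {Ω : ℝ} {f : ℝ → ℂ} (hf : IsBandlimited Ω f) (T : ℝ) :
    IsBandlimited Ω (fwdDiff T f) := by
  obtain ⟨G, hG, hsupp, rfl⟩ := hf
  have hexp : Integrable
      (fun ξ : ℝ => Complex.exp (↑(-2 * π * ξ * T) * Complex.I) * G ξ) := by
    refine hG.norm.mono' ((by fun_prop : Continuous fun ξ : ℝ =>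
      Complex.exp (↑(-2 * π * ξ * T) * Complex.I)).aestronglyMeasurable.mul hG.1) ?_
    filter_upwards with ξ
    rw [norm_mul, Complex.norm_exp_ofReal_mul_I, one_mul]
  refine ⟨fun ξ => Complex.exp (↑(-2 * π * ξ * T) * Complex.I) * G ξ - G ξ, hexp.sub hG, ?_, ?_⟩
  · filter_upwards [hsupp] with ξ hξ h
    simp [hξ h]
  · funext t
    have hI : ∀ (H : ℝ → ℂ), Integrable H → Integrable
        (fun ξ : ℝ => Complex.exp (↑(-2 * π * ξ * t) * Complex.I) • H ξ) := fun H hH => by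
      refine hH.norm.mono' ((by fun_prop : Continuous fun ξ : ℝ =>
        Complex.exp (↑(-2 * π * ξ * t) * Complex.I)).aestronglyMeasurable.smul hH.1) ?_
      filter_upwards with ξ
      rw [norm_smul, Complex.norm_exp_ofReal_mul_I, one_mul]
    simp only [fwdDiff, Real.fourier_real_eq_integral_exp_smul, smul_sub]
    rw [integral_sub (hI _ hexp) (hI _ hG)]
    congr 2
    funext ξ
    rw [smul_eq_mul, smul_eq_mul, ← mul_assoc, ← Complex.exp_add]
    congr 2
    push_cast
    ring

theorem IsBandlimited.norm_iterate_fwdDiff_le {Ω : ℝ} (hΩ : 0 < Ω) {T : ℝ} (hT : 0 ≤ T)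
    {f : ℝ → ℂ} (hf : IsBandlimited Ω f) {C : ℝ} (hC : ∀ t, ‖f t‖ ≤ C) (n : ℕ) (t : ℝ) :
    ‖(fwdDiff T)^[n] f t‖ ≤ (Ω * T) ^ n * C := by
  induction n generalizing f C t with
  | zero => simpa using hC t
  | succ n ih =>
    rw [Function.iterate_succ_apply]
    refine (ih (hf.comp_fwdDiff T) (fun s => hf.norm_add_sub_le hΩ hC hT s) t).trans_eq (by ring)

/-! ### Paley-Wiener signals are bandlimited -/

/-- Fourier inversion for an `L²` function with integrable transform. -/
theorem ae_eq_fourierInv_of_integrable (f : Lp ℂ 2 (volume : Measure ℝ))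
    (hG : Integrable (𝓕 f : Lp ℂ 2 (volume : Measure ℝ))) :
    f =ᵐ[volume] 𝓕 (fun ξ : ℝ => (𝓕 f : Lp ℂ 2 (volume : Measure ℝ)) (-ξ)) := by
  set G : ℝ → ℂ := ⇑(𝓕 f : Lp ℂ 2 (volume : Measure ℝ)) with hGdef
  have hGn : Integrable (fun ξ => G (-ξ)) := hG.comp_neg
  refine ae_eq_of_integral_contDiff_smul_eq ((Lp.memLp f).locallyIntegrable (by norm_num))
    (Continuous.locallyIntegrable (VectorFourier.fourierIntegral_continuous
      Real.continuous_fourierChar (L := innerₗ ℝ) continuous_inner hGn)) fun φ hφ hφc => ?_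
  have hφc' : HasCompactSupport (Complex.ofRealCLM ∘ φ) := hφc.comp_left rfl
  set ψ : SchwartzMap ℝ ℂ := hφc'.toSchwartzMap (by fun_prop) with hψ
  have h1 := congrArg (fun D : TemperedDistribution ℝ ℂ => D (𝓕⁻ ψ))
    (Lp.fourier_toTemperedDistribution_eq f)
  simp only [TemperedDistribution.fourier_apply, FourierTransform.fourier_fourierInv_eq,
    Lp.toTemperedDistribution_apply] at h1
  have h2 : ∫ x, ψ x • f x = ∫ ξ, 𝓕 (ψ : ℝ → ℂ) ξ • G (-ξ) := by
    rw [h1, ← integral_neg_eq_self]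
    refine integral_congr_ae (Eventually.of_forall fun ξ => ?_)
    simp only [SchwartzMap.fourierInv_coe]
    rw [Real.fourierInv_eq_fourier_neg, neg_neg]
  have h3 := VectorFourier.integral_fourierIntegral_smul_eq_flip (L := innerₗ ℝ)
      Real.continuous_fourierChar continuous_inner (ψ.integrable (μ := volume)) hGn
  rw [flip_innerₗ] at h3
  exact h2.trans h3

theorem PaleyWiener.isBandlimited {Ω : ℝ} {g : ℝ → ℝ} (hg : PaleyWiener Ω g) :
    IsBandlimited Ω (fun t => (g t : ℂ)) := by
  obtain ⟨hcont, h, hsupp⟩ := hg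
  set f := h.toLp (fun t : ℝ => (g t : ℂ)) with hf
  have hG : Integrable (𝓕 f : Lp ℂ 2 (volume : Measure ℝ)) := by
    refine IntegrableOn.integrable_of_ae_notMem_eq_zero
      (s := Set.Icc (-(Ω / (2 * π))) (Ω / (2 * π))) ?_ ?_
    · exact ((Lp.memLp _).restrict _).integrable (by norm_num)
    · filter_upwards [hsupp] with ξ hξ hmem
      refine hξ ?_
      by_contra hcon
      refine hmem (abs_le.1 ?_)
      rw [not_lt, abs_mul, abs_of_pos (by positivity : 0 < 2 * π)] at hcon
      rw [le_div_iff₀ (by positivity)]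
      linarith
  refine ⟨_, hG.comp_neg, ?_, ?_⟩
  · have := (Measure.measurePreserving_neg (volume : Measure ℝ)).quasiMeasurePreserving.ae hsupp
    filter_upwards [this] with ξ hξ hlt
    exact hξ (by simpa using hlt)
  · refine (Continuous.ae_eq_iff_eq volume (by fun_prop) ?_).1
      (h.coeFn_toLp.symm.trans (ae_eq_fourierInv_of_integrable f hG))
    exact VectorFourier.fourierIntegral_continuous
      Real.continuous_fourierChar (L := innerₗ ℝ) continuous_inner hG.comp_neg


/-! ### The sup norm -/

theorem supNorm_nonneg {ι : Type*} (x : ι → ℝ) : 0 ≤ supNorm x :=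
  Real.sInf_nonneg fun _ hc => hc.1

theorem abs_le_supNorm {ι : Type*} {x : ι → ℝ} (hx : BddAbove (Set.range fun i => |x i|)) (i : ι) :
    |x i| ≤ supNorm x := by
  obtain ⟨c, hc⟩ := hx
  have hc' : ∀ j, |x j| ≤ c := fun j => hc ⟨j, rfl⟩
  exact le_csInf ⟨c, (abs_nonneg _).trans (hc' i), hc'⟩ fun b hb => hb.2 i

theorem supNorm_eq_zero {ι : Type*} {x : ι → ℝ} (hx : ∀ i, x i = 0) : supNorm x = 0 :=
  le_antisymm (csInf_le ⟨0, fun _ hc => hc.1⟩ ⟨le_rfl, fun i => by simp [hx i]⟩) (supNorm_nonneg x)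

/-! ### Differences, anti-differences and the modulo operation -/

theorem diff_add (N : ℕ) (x y : ℤ → ℝ) : diff N (x + y) = diff N x + diff N y :=
  fwdDiff_iter_add ..

theorem diff_sub (N : ℕ) (x y : ℤ → ℝ) : diff N (x - y) = diff N x - diff N y := by
  rw [eq_sub_iff_add_eq, ← diff_add, sub_add_cancel]

theorem diff_succ (N : ℕ) (x : ℤ → ℝ) : diff (N + 1) x = fwdDiff 1 (diff N x) :=
  Function.iterate_succ_apply' ..

theorem abs_diff_le {x : ℤ → ℝ} {C : ℝ} (hx : ∀ k, |x k| ≤ C) (N : ℕ) (k : ℤ) :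
    |diff N x k| ≤ 2 ^ N * C := by
  induction N generalizing k with
  | zero => simpa [diff] using hx k
  | succ N ih =>
    rw [diff_succ, fwdDiff]
    refine (abs_sub _ _).trans ?_
    rw [pow_succ]
    linarith [ih (k + 1), ih k]

theorem diff_samples (g : ℝ → ℝ) (T : ℝ) (N : ℕ) (k : ℤ) :
    diff N (samples g T) k = (fwdDiff T)^[N] g (k * T) := by
  induction N generalizing k with
  | zero => rfl
  | succ N ih =>
    rw [diff_succ, fwdDiff, Function.iterate_succ_apply', fwdDiff, ih, ih]
    push_cast
    ring_nf

theorem iterate_fwdDiff_ofReal (g : ℝ → ℝ) (T : ℝ) (N : ℕ) (t : ℝ) :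
    (fwdDiff T)^[N] (fun t => (g t : ℂ)) t = ((fwdDiff T)^[N] g t : ℝ) := by
  induction N generalizing t with
  | zero => rfl
  | succ N ih =>
    rw [Function.iterate_succ_apply', fwdDiff, ih, ih, Function.iterate_succ_apply', fwdDiff,
      Complex.ofReal_sub]

/-- Higher differences of the samples of a bandlimited signal contract by the factor `ΩT`. -/
theorem PaleyWiener.abs_diff_samples_le {Ω T : ℝ} (hΩ : 0 < Ω) (hT : 0 < T) {g : ℝ → ℝ}
    (hg : PaleyWiener Ω g) (hgb : BddAbove (Set.range fun t : ℝ => |g t|)) (N : ℕ) (k : ℤ) :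
    |diff N (samples g T) k| ≤ (Ω * T) ^ N * supNorm g := by
  have h := hg.isBandlimited.norm_iterate_fwdDiff_le hΩ hT.le (C := supNorm g)
    (fun t => by simpa using abs_le_supNorm hgb t) N (k * T)
  rwa [iterate_fwdDiff_ofReal, Complex.norm_real, Real.norm_eq_abs, ← diff_samples] at h

theorem antiDiff_one (x : ℤ → ℝ) : antiDiff x 1 = 0 := by simp [antiDiff]

theorem antiDiff_fwdDiff (x : ℤ → ℝ) (k : ℤ) : antiDiff (fwdDiff 1 x) k = x k - x 1 := by
  induction k using Int.inductionOn' (b := 1) with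
  | zero => simp [antiDiff_one]
  | succ k hk ih =>
    have h1 : Finset.Ico 1 (k + 1) = insert k (Finset.Ico 1 k) := by ext; simp; omega
    have h2 : Finset.Ico (k + 1) 1 = ∅ := by simp; omega
    have h3 : Finset.Ico k 1 = ∅ := by simp; omega
    simp only [antiDiff, h1, h2, h3, Finset.sum_empty, sub_zero] at ih ⊢
    rw [Finset.sum_insert (by simp), ih, fwdDiff]
    ring
  | pred k hk ih =>
    have h1 : Finset.Ico (k - 1) 1 = insert (k - 1) (Finset.Ico k 1) := by ext; simp; omega
    have h2 : Finset.Ico 1 (k - 1) = ∅ := by simp; omega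
    have h3 : Finset.Ico 1 k = ∅ := by simp; omega
    simp only [antiDiff, h1, h2, h3, Finset.sum_empty, zero_sub] at ih ⊢
    rw [Finset.sum_insert (by simp), fwdDiff, sub_add_cancel]
    linarith

theorem abs_modulo_le {lam : ℝ} (hlam : 0 < lam) (x : ℝ) : |modulo lam x| ≤ lam := by
  have h1 := Int.floor_le ((x + lam) / (2 * lam))
  have h2 := Int.lt_floor_add_one ((x + lam) / (2 * lam))
  rw [le_div_iff₀ (by positivity)] at h1
  rw [div_lt_iff₀ (by positivity)] at h2
  rw [modulo, abs_le]
  constructor <;> linarith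

theorem modulo_sub_eq_self {lam x : ℝ} (hx : |x| < lam) (n : ℤ) :
    modulo lam (x - 2 * lam * n) = x := by
  have hlam : 0 < lam := (abs_nonneg x).trans_lt hx
  obtain ⟨h1, h2⟩ := abs_lt.1 hx
  have : ⌊(x - 2 * lam * n + lam) / (2 * lam)⌋ = -n := by
    rw [Int.floor_eq_iff, le_div_iff₀ (by positivity), div_lt_iff₀ (by positivity)]
    push_cast
    constructor <;> linarith
  rw [modulo, this]
  push_cast
  ring

/-- The sequence `x` takes its values in the lattice `2λℤ`. -/
def IsLatticeValued (lam : ℝ) (x : ℤ → ℝ) : Prop :=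
  ∀ k, ∃ n : ℤ, x k = 2 * lam * n

theorem IsLatticeValued.diff {lam : ℝ} {x : ℤ → ℝ} (hx : IsLatticeValued lam x) (N : ℕ) :
    IsLatticeValued lam (diff N x) := by
  induction N with
  | zero => exact hx
  | succ N ih =>
    intro k
    obtain ⟨a, ha⟩ := ih (k + 1)
    obtain ⟨b, hb⟩ := ih k
    refine ⟨a - b, ?_⟩
    rw [diff_succ, fwdDiff, ha, hb]
    push_cast
    ring

/-! ### The loop of the algorithm -/

/-- Averaging the second anti-difference over a block of length `J` identifies the constant of
integration: the error of the average is the increment of `z` over the block, divided by `J`. -/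
theorem kappa_fwdDiff_fwdDiff {lam : ℝ} {J : ℤ} {z : ℤ → ℝ}
    (hz : |z (J + 1) - z 1| < J * lam) {n : ℤ} (hn : fwdDiff 1 z 1 = 2 * lam * n) :
    kappa lam J (fwdDiff 1 (fwdDiff 1 z)) = n := by
  have hJlam : 0 < 2 * J * lam := by linarith [(abs_nonneg _).trans_lt hz]
  have hS : antiDiff (fwdDiff 1 (fwdDiff 1 z)) = fwdDiff 1 fun k => z k - 2 * lam * n * k := by
    funext k
    rw [antiDiff_fwdDiff, hn]
    simp only [fwdDiff]
    push_cast
    ring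
  obtain ⟨h1, h2⟩ := abs_lt.1 hz
  rw [kappa, hS, antiDiff_fwdDiff, antiDiff_fwdDiff, Int.floor_eq_iff, ← sub_le_iff_le_add,
    ← lt_sub_iff_add_lt, le_div_iff₀ hJlam, div_lt_iff₀ hJlam]
  push_cast
  constructor <;> linarith

theorem loopStep_fwdDiff_fwdDiff {lam : ℝ} (hlam : 0 < lam) {J : ℤ} {z : ℤ → ℝ}
    (hz : |z (J + 1) - z 1| < J * lam) (hlat : IsLatticeValued lam (fwdDiff 1 z)) :
    loopStep lam J (fwdDiff 1 (fwdDiff 1 z)) = fwdDiff 1 z := by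
  funext k
  obtain ⟨n, hn⟩ := hlat 1
  obtain ⟨d, hd⟩ := hlat k
  have : (fwdDiff 1 z k - fwdDiff 1 z 1) / lam / 2 = ((d - n : ℤ) : ℝ) := by
    rw [hn, hd]
    push_cast
    field_simp
  rw [loopStep, kappa_fwdDiff_fwdDiff hz hn, antiDiff_fwdDiff, this, round_intCast, hd]
  push_cast
  ring

theorem iterate_loopStep_diff {lam : ℝ} (hlam : 0 < lam) {J : ℤ} {e : ℤ → ℝ}
    (hlat : IsLatticeValued lam e) {N : ℕ}
    (he : ∀ j, j + 2 ≤ N → |diff j e (J + 1) - diff j e 1| < J * lam) {i : ℕ} (hi : i + 1 ≤ N) :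
    (loopStep lam J)^[i] (diff N e) = diff (N - i) e := by
  induction i with
  | zero => rfl
  | succ i ih =>
    obtain ⟨j, rfl⟩ := Nat.exists_eq_add_of_le hi
    rw [Function.iterate_succ_apply', ih (by omega), show i + 1 + 1 + j - i = j + 1 + 1 by omega,
      show i + 1 + 1 + j - (i + 1) = j + 1 by omega, diff_succ, diff_succ]
    exact loopStep_fwdDiff_fwdDiff hlam (he j (by omega))
      (by simpa only [← diff_succ] using hlat.diff (j + 1))

theorem le_blockLength_mul {lam β : ℝ} (hlam : 0 < lam) (N : ℕ) :
    4 * β + 2 ^ N * lam ≤ blockLength lam β N * lam := by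
  have h := Int.le_ceil (4 * (β / lam + (2 : ℝ) ^ ((N : ℤ) - 2)))
  rw [zpow_sub₀ two_ne_zero, zpow_natCast] at h
  calc 4 * β + 2 ^ N * lam = 4 * (β / lam + 2 ^ N / 2 ^ (2 : ℤ)) * lam := by
        field_simp
        norm_num
        ring
    _ ≤ _ := by
        rw [blockLength, zpow_sub₀ two_ne_zero, zpow_natCast]
        exact mul_le_mul_of_nonneg_right h hlam.le

/-- The algorithm recovers `γ + η` whenever the `N`-th differences of `γ + η` stay below the
threshold, and the lower order differences of `γ` stay below `β + λ`. -/
theorem recover_eq {lam β : ℝ} (hlam : 0 < lam) (hβ : 0 ≤ β) {N : ℕ} (hN : 1 ≤ N)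
    {γ η : ℤ → ℝ} (htop : ∀ k, |diff N (γ + η) k| < lam)
    (hlow : ∀ j, j + 2 ≤ N → ∀ k, |diff j γ k| < β + lam) (m₀ : ℤ) :
    ∃ m : ℤ, ∀ k, recover lam β N (fun k => modulo lam (γ k) + η k) m₀ k
      = γ k + η k + 2 * m * lam := by
  set y : ℤ → ℝ := fun k => modulo lam (γ k) + η k with hy
  -- The folding error, which the algorithm reconstructs up to a constant.
  set e : ℤ → ℝ := fun k => γ k - modulo lam (γ k) with he
  have hlat : IsLatticeValued lam e := fun k => ⟨⌊(γ k + lam) / (2 * lam)⌋, by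
    simp only [he, modulo, sub_sub_cancel]⟩
  have hyeq : y = (γ + η) - e := by
    funext k
    simp only [hy, he, Pi.sub_apply, Pi.add_apply]
    ring
  have hs : unwrappedDiff lam N y = diff N e := by
    funext k
    obtain ⟨n, hn⟩ := hlat.diff N k
    rw [unwrappedDiff, hyeq, diff_sub, Pi.sub_apply, hn, modulo_sub_eq_self (htop k)]
    ring
  have hJlam := le_blockLength_mul (β := β) hlam N
  have hinc : ∀ j, j + 2 ≤ N →
      |diff j e (blockLength lam β N + 1) - diff j e 1| < blockLength lam β N * lam := by
    intro j hj
    have hb : ∀ k, |diff j e k| < β + lam + 2 ^ j * lam := fun k => by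
      have hee : e = γ - fun k => modulo lam (γ k) := rfl
      rw [hee, diff_sub, Pi.sub_apply]
      exact (abs_sub _ _).trans_lt
        (add_lt_add_of_lt_of_le (hlow j hj k) (abs_diff_le (fun _ => abs_modulo_le hlam _) j k))
    have hpow : (2 : ℝ) ^ j * 4 ≤ 2 ^ N := by
      calc (2 : ℝ) ^ j * 4 = 2 ^ (j + 2) := by ring
        _ ≤ 2 ^ N := pow_le_pow_right₀ one_le_two hj
    have hone : (1 : ℝ) ≤ 2 ^ j := one_le_pow₀ one_le_two
    have h1 := hb (blockLength lam β N + 1)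
    have h2 := hb 1
    have h3 := mul_le_mul_of_nonneg_right hpow hlam.le
    have h4 := mul_le_mul_of_nonneg_right hone hlam.le
    refine (abs_sub _ _).trans_lt ?_
    linarith
  obtain ⟨n, hn⟩ := hlat 1
  refine ⟨m₀ - n, fun k => ?_⟩
  rw [recover, hs, iterate_loopStep_diff hlam hlat hinc (by omega), Nat.sub_sub_self hN,
    diff_succ, antiDiff_fwdDiff]
  have hyk := congrFun hyeq k
  simp only [Pi.sub_apply, Pi.add_apply] at hyk
  change e k - e 1 + y k + _ = _
  rw [hyk, hn]
  push_cast
  ring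

theorem RecoveryCondition.exists_recover_eq {lam Ω T β : ℝ} (hlam : 0 < lam) (hΩ : 0 < Ω)
    (hT : 0 < T) {g : ℝ → ℝ} (hg : PaleyWiener Ω g)
    (hgb : BddAbove (Set.range fun t : ℝ => |g t|)) (hβ : supNorm g ≤ β)
    {η : ℤ → ℝ} (hη : BddAbove (Set.range fun k : ℤ => |η k|)) {N : ℕ} (hN : 1 ≤ N)
    (h : RecoveryCondition lam Ω T g η N) (m₀ : ℤ) :
    ∃ m : ℤ, ∀ k : ℤ, recover lam β N (noisyModuloSamples lam g T η) m₀ k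
      = samples g T k + η k + 2 * m * lam := by
  have hβ0 : 0 ≤ β := (supNorm_nonneg g).trans hβ
  refine recover_eq hlam hβ0 hN (fun k => ?_) (fun j hj k => ?_) m₀
  · rw [diff_add]
    exact ((abs_add_le _ _).trans (add_le_add (hg.abs_diff_samples_le hΩ hT hgb N k)
      (abs_diff_le (abs_le_supNorm hη) N k))).trans_lt h
  · refine (hg.abs_diff_samples_le hΩ hT hgb j k).trans_lt ?_
    -- For `ΩT ≤ 1` the differences are bounded by `‖g‖ ≤ β`, otherwise by those of order `N`.
    rcases le_total (Ω * T) 1 with hle | hge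
    · have := mul_le_mul_of_nonneg_right (pow_le_one₀ (n := j) (by positivity) hle)
        (supNorm_nonneg g)
      linarith
    · have h1 := mul_le_mul_of_nonneg_right (pow_le_pow_right₀ hge (by omega : j ≤ N))
        (supNorm_nonneg g)
      have h2 : 0 ≤ 2 ^ N * supNorm η := mul_nonneg (by positivity) (supNorm_nonneg η)
      have h3 : (Ω * T) ^ N * supNorm g + 2 ^ N * supNorm η < lam := h
      linarith

/-! ### The sampling condition in terms of the oversampling factor -/

theorem recoveryCondition_iff {lam Ω T : ℝ} (hlam : 0 < lam) (hΩ : 0 < Ω) (hT : 0 < T)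
    (g : ℝ → ℝ) (η : ℤ → ℝ) {N : ℕ} (hN : 1 ≤ N) :
    RecoveryCondition lam Ω T g η N ↔
      2 ^ N * (supNorm η / lam) < 1 ∧
      oversamplingFactor Ω T >
        π * ((supNorm g / lam) / (1 - 2 ^ N * (supNorm η / lam))) ^ (1 / (N : ℝ)) := by
  have hρ : 0 ≤ supNorm g / lam := div_nonneg (supNorm_nonneg g) hlam.le
  have hOF : oversamplingFactor Ω T = π * (Ω * T)⁻¹ := by
    rw [oversamplingFactor]
    field_simp
  set q := 1 - 2 ^ N * (supNorm η / lam) with hq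
  have hcond : RecoveryCondition lam Ω T g η N ↔ supNorm g / lam * (Ω * T) ^ N < q := by
    rw [RecoveryCondition, ← div_lt_one hlam, hq, lt_sub_iff_add_lt]
    refine iff_of_eq (congrArg (· < 1) ?_)
    ring
  have hq0 : 2 ^ N * (supNorm η / lam) < 1 ↔ 0 < q := by rw [hq, sub_pos]
  have hNpos : (0 : ℝ) < N := by exact_mod_cast hN
  have hmain : 0 < q → (supNorm g / lam * (Ω * T) ^ N < q ↔
      oversamplingFactor Ω T > π * ((supNorm g / lam) / q) ^ (1 / (N : ℝ))) := fun hqpos => by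
    rw [hOF, gt_iff_lt, mul_lt_mul_iff_right₀ pi_pos, one_div,
      rpow_inv_lt_iff_of_pos (by positivity) (by positivity) hNpos, rpow_natCast, inv_pow,
      div_lt_iff₀ hqpos, inv_mul_eq_div, lt_div_iff₀ (by positivity)]
  rw [hcond, hq0]
  refine ⟨fun h => ?_, fun h => (hmain h.1).2 h.2⟩
  have hqpos : 0 < q := (mul_nonneg hρ (by positivity)).trans_lt h
  exact ⟨hqpos, (hmain hqpos).1 h⟩

theorem tendsto_pi_mul_rpow_one_div {ρ : ℝ} (hρ : ρ ≠ 0) :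
    Tendsto (fun n : ℕ => π * ρ ^ (1 / (n : ℝ))) atTop (𝓝 π) := by
  have h := ((continuousAt_const_rpow hρ (b := 0)).tendsto.comp
    (tendsto_one_div_atTop_nhds_zero_nat (𝕜 := ℝ))).const_mul π
  simpa using! h

end ModuloSampling

theorem theorem1
    (lam Ω T β : ℝ) (hlam : 0 < lam) (hΩ : 0 < Ω) (hT : 0 < T)
    (g : ℝ → ℝ) (hg : ModuloSampling.PaleyWiener Ω g)
    (hgb : BddAbove (Set.range fun t : ℝ => |g t|))
    (hβ : ModuloSampling.supNorm g ≤ β)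
    (η : ℤ → ℝ) (hη : BddAbove (Set.range fun k : ℤ => |η k|))
    (N : ℕ) (hN : 1 ≤ N) :
    -- the algorithm recovers the noisy samples up to a global constant in `2λℤ`
    (ModuloSampling.RecoveryCondition lam Ω T g η N →
      ∀ m₀ : ℤ, ∃ m : ℤ, ∀ k : ℤ,
        ModuloSampling.recover lam β N (ModuloSampling.noisyModuloSamples lam g T η) m₀ k
          = ModuloSampling.samples g T k + η k + 2 * m * lam) ∧
    -- the condition as an oversampling requirement
    (ModuloSampling.RecoveryCondition lam Ω T g η N ↔
      2 ^ N * (ModuloSampling.supNorm η / lam) < 1 ∧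
      ModuloSampling.oversamplingFactor Ω T >
        π * ((ModuloSampling.supNorm g / lam) /
          (1 - 2 ^ N * (ModuloSampling.supNorm η / lam))) ^ (1 / (N : ℝ))) ∧
    -- the noiseless case
    ((∀ k, η k = 0) →
      (ModuloSampling.RecoveryCondition lam Ω T g η N ↔
        ModuloSampling.oversamplingFactor Ω T >
          π * (ModuloSampling.supNorm g / lam) ^ (1 / (N : ℝ)))) ∧
    -- the noiseless threshold tends to `π` as the order grows, for a nonzero signal
    (g ≠ 0 →
      Tendsto (fun n : ℕ => π * (ModuloSampling.supNorm g / lam) ^ (1 / (n : ℝ)))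
        atTop (𝓝 π)) := by
  refine ⟨fun h => h.exists_recover_eq hlam hΩ hT hg hgb hβ hη hN,
    ModuloSampling.recoveryCondition_iff hlam hΩ hT g η hN, fun h0 => ?_, fun hg0 => ?_⟩
  · rw [ModuloSampling.recoveryCondition_iff hlam hΩ hT g η hN, ModuloSampling.supNorm_eq_zero h0]
    simp
  · refine ModuloSampling.tendsto_pi_mul_rpow_one_div (div_ne_zero (fun h => hg0 ?_) hlam.ne')
    funext t
    simpa [h] using ModuloSampling.abs_le_supNorm hgb t
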